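/- Let $n$ and $k$ be positive integers, and for $1\le i\le k$ let $n_i,s_i$ be positive integers with $s_i+n_i-1\le n$ and let $\lambda^{(i)}=(\lambda^{(i)}_1\ge\cdots\ge\lambda^{(i)}_{n_i}\ge 0)$ be a partition with $n_i$ parts (zero parts allowed). Put $X=\{(\lambda^{(i)},n_i,s_i):1\le i\le k\}$ (a finite family; repetitions are allowed), and write $\delta_m=(m-1,m-2,\dots,1,0)$. Let $P_n(X)$ be the poset constructed as follows. Start with a chain $x_1<x_2<\cdots<x_n$. For each $i$ take the shifted Young diagram $(\lambda^{(i)}+\delta_{n_i+1})^*$, whose $r$-th row, $1\le r\le n_i$, occupies the columns $r,r+1,\dots,n_i+\lambda^{(i)}_r$, ordered by: $u\le v$ if $u$ is weakly below and weakly to the right of $v$. Identify its diagonal cells $(1,1),(2,2),\dots,(n_i,n_i)$ with $x_{s_i+n_i-1},x_{s_i+n_i-2},\dots,x_{s_i}$, respectively, and take on the resulting set the transitive closure of all these order relations. For $1\le i\le n$ let $\ell_i$ be the number of elements of level $i$ in $P_n(X)$, i.e. of elements $y$ with $y\le x_i$ and $y\not\le x_{i-1}$ (the last condition being void for $i=1$).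 Let $0<q<1$ and $\mathrm{GF}(P)=\sum_{\sigma}q^{|\sigma|}$, where $\sigma$ runs over all order-reversing maps $\sigma:P\to\{0,1,2,\dots\}$ and $|\sigma|=\sum_{x\in P}\sigma(x)$. Let $(a;q)_m=\prod_{i=0}^{m-1}(1-aq^i)$, let $a_\mu(y_1,\dots,y_m)=\det(y_i^{\mu_j})_{i,j=1}^m$, let $\int_a^b f(x)\,d_qx=(1-q)\sum_{i\ge 0}\bigl(f(bq^i)bq^i-f(aq^i)aq^i\bigr)$, and $$\int_{0\le x_1\le\cdots\le x_n\le1}f\,d_qx_1\cdots d_qx_n=\int_0^1\int_0^{x_n}\cdots\int_0^{x_2}f(x_1,\dots,x_n)\,d_qx_1\cdots d_qx_n .$$ **Theorem.** Suppose that for every $1\le j\le n-1$ there is $1\le i\le k$ such that $s_i\le j<j+1\le s_i+n_i-1$. Then the series $\mathrm{GF}(P_n(X))$ and the $q$-integrals below converge absolutely, and $$\mathrm{GF}(P_n(X))=\frac{q^{-\sum_{i=1}^n(n-i)\ell_i}}{(1-q)^n}\int_{0\le x_1\le\cdots\le x_n\le1}\ \prod_{i=1}^k\frac{(-1)^{\binom{n_i}{2}}\,a_{\lambda^{(i)}+\delta_{n_i}}(x_{s_i},x_{s_i+1},\dots,x_{s_i+n_i-1})}{\prod_{j=1}^{n_i}(q;q)_{\lambda^{(i)}_j+n_i-j}}\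 d_qx_1\cdots d_qx_n .$$ -/

import Mathlib

open scoped BigOperators

namespace QAttach

noncomputable section

/-! ### `P`-partitions -/

/-- A `P`-partition: an order-reversing map `P → ℕ`. -/
def PPartition (P : Type*) [PartialOrder P] : Type _ := {σ : P → ℕ // Antitone σ}

/-- The size `|σ|`, the sum of all values of `σ`. -/
def PPartition.size {P : Type*} [PartialOrder P] [Fintype P] (σ : PPartition P) : ℕ :=
  ∑ x, σ.1 x

/-- The `P`-partition generating function `GF(P) = ∑_σ q^{|σ|}` at a real number `q`. -/
def GF (q : ℝ) (P : Type*) [PartialOrder P] [Fintype P] : ℝ :=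
  ∑' σ : PPartition P, q ^ σ.size

/-! ### `q`-notation and alternants -/

/-- `(a;q)_m = (1 - a)(1 - aq)⋯(1 - aq^{m-1})`. -/
def qPoch (a q : ℝ) (m : ℕ) : ℝ := ∏ i ∈ Finset.range m, (1 - a * q ^ i)

/-- The alternant `a_μ(x_1,…,x_m) = det (x_i ^ μ_j)`. -/
def alternant {m : ℕ} (μ : Fin m → ℕ) (x : Fin m → ℝ) : ℝ :=
  Matrix.det (Matrix.of fun i j => x i ^ μ j)

/-- The staircase `δ_m = (m-1, m-2, …, 1, 0)`. -/
def staircase (m : ℕ) (j : Fin m) : ℕ := m - 1 - (j : ℕ)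

/-! ### `q`-integrals -/

/-- The terms `(1 - q) (f(b q^i) b q^i - f(a q^i) a q^i)` of the `q`-integral of `f` over
`[a, b]`. -/
def qTerm (q : ℝ) (f : ℝ → ℝ) (a b : ℝ) (i : ℕ) : ℝ :=
  (1 - q) * (f (b * q ^ i) * (b * q ^ i) - f (a * q ^ i) * (a * q ^ i))

/-- The `q`-integral `∫_a^b f(x) d_q x`. -/
def qIntegral (q : ℝ) (f : ℝ → ℝ) (a b : ℝ) : ℝ := ∑' i, qTerm q f a b i

/-- Absolute convergence of the `q`-integral of `f` over `[a, b]`. -/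
def QIntegrable (q : ℝ) (f : ℝ → ℝ) (a b : ℝ) : Prop := Summable fun i => |qTerm q f a b i|

/-- The iterated `q`-integral over `0 ≤ x_1 ≤ ⋯ ≤ x_m ≤ b`,
`∫_0^b ∫_0^{x_m} ⋯ ∫_0^{x_2} f(x_1,…,x_m) d_q x_1 ⋯ d_q x_m` (the outermost variable is the
last one). -/
def simplexQIntegral (q : ℝ) : (m : ℕ) → ((Fin m → ℝ) → ℝ) → ℝ → ℝ
  | 0, f, _ => f Fin.elim0
  | m + 1, f, b =>
      qIntegral q (fun y => simplexQIntegral q m (fun x => f (Fin.snoc x y)) y) 0 b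

/-- Absolute convergence of every one-variable `q`-integral that occurs in
`simplexQIntegral q m f b`. -/
def SimplexQIntegrable (q : ℝ) : (m : ℕ) → ((Fin m → ℝ) → ℝ) → ℝ → Prop
  | 0, _, _ => True
  | m + 1, f, b =>
      (∀ y ∈ Set.Icc 0 b, SimplexQIntegrable q m (fun x => f (Fin.snoc x y)) y) ∧
        QIntegrable q (fun y => simplexQIntegral q m (fun x => f (Fin.snoc x y)) y) 0 b

/-! ### Shifted Young posets -/

/-- The cells of the shifted Young diagram with row lengths `μ`: the pair `⟨r, t⟩` is the `t`-th
cell of row `r` (both counted from `0`); as row `r` is shifted by `r` units, it lies in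
column `r + t`. The leftmost cells `⟨r, 0⟩` are the diagonal cells. -/
def ShiftedCell {m : ℕ} (μ : Fin m → ℕ) : Type := Σ r : Fin m, Fin (μ r)

namespace ShiftedCell

variable {m : ℕ} {μ : Fin m → ℕ}

instance : Fintype (ShiftedCell μ) := inferInstanceAs (Fintype (Σ r : Fin m, Fin (μ r)))

instance : DecidableEq (ShiftedCell μ) :=
  inferInstanceAs (DecidableEq (Σ r : Fin m, Fin (μ r)))

/-- The row of a cell, counted from `0`. -/
def row (c : ShiftedCell μ) : Fin m := c.1

/-- The column of a cell, counted from `0`. -/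
def col (c : ShiftedCell μ) : ℕ := (c.1 : ℕ) + (c.2 : ℕ)

/-- A cell is diagonal if it is the leftmost cell of its row. -/
def IsDiag (c : ShiftedCell μ) : Prop := c.col = (c.row : ℕ)

instance (c : ShiftedCell μ) : Decidable c.IsDiag := inferInstanceAs (Decidable (_ = _))

theorem ext_row_col {c d : ShiftedCell μ} (h : c.row = d.row) (h' : c.col = d.col) : c = d := by
  obtain ⟨r, t⟩ := c
  obtain ⟨r', t'⟩ := d
  simp only [row] at h
  subst h
  simp only [col, Nat.add_left_cancel_iff] at h'
  rw [Fin.ext h']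

/-- `c ≤ d` if `c` is weakly below and weakly to the right of `d`. -/
instance : PartialOrder (ShiftedCell μ) where
  le c d := d.row ≤ c.row ∧ d.col ≤ c.col
  le_refl c := ⟨le_rfl, le_rfl⟩
  le_trans _ _ _ h h' := ⟨h'.1.trans h.1, h'.2.trans h.2⟩
  le_antisymm _ _ h h' := ext_row_col (le_antisymm h'.1 h.1) (le_antisymm h'.2 h.2)

end ShiftedCell

/-! ### The poset `P_n(X)` -/

/-- A triple `(λ, m, s)`: a partition `λ = (λ_1 ≥ ⋯ ≥ λ_m ≥ 0)` (zero parts allowed), together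
with a segment of `m ≥ 1` consecutive diagonal entries among `n`. Diagonal entries are counted
from `0`, so `start` is `s - 1` and the segment consists of the positions
`start, …, start + size - 1`. -/
structure Piece (n : ℕ) where
  size : ℕ
  size_pos : 0 < size
  start : ℕ
  fits : start + size ≤ n
  shape : Fin size → ℕ
  shape_antitone : Antitone shape

namespace Piece

variable {n : ℕ} (p : Piece n)

/-- The `j`-th diagonal entry of the segment. -/
def pos (j : Fin p.size) : Fin n := ⟨p.start + j, by have := p.fits; have := j.2; omega⟩

/-- The strict partition `λ + δ_{m+1}`, where `δ_{m+1} = (m, m-1, …, 1, 0)`; its last part,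
which is `0`, is left out. -/
def strictShape (r : Fin p.size) : ℕ := p.shape r + staircase (p.size + 1) r.castSucc

/-- The cells of the shifted diagram `(λ + δ_{m+1})^*`. -/
abbrev Cell : Type := ShiftedCell p.strictShape

/-- The partition `λ + δ_m`. -/
def exponent (j : Fin p.size) : ℕ := p.shape j + staircase p.size j

/-- The normalized alternant
`(-1)^{m(m-1)/2} a_{λ+δ_m}(x_s,…,x_{s+m-1}) / ∏_j (q;q)_{λ_j+m-j}`. -/
def factor (q : ℝ) (x : Fin n → ℝ) : ℝ :=
  (-1) ^ (p.size.choose 2) * alternant p.exponent (fun j => x (p.pos j)) /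
    ∏ j, qPoch q q (p.exponent j)

end Piece

variable {n k : ℕ}

/-- The underlying set of `P_n(X)`: the `n` diagonal entries, and for each piece the
off-diagonal cells of its shifted diagram (the diagonal cells are identified with the diagonal
entries of the segment, see `AttachedPoset.cell`). -/
def AttachedPoset (X : Fin k → Piece n) : Type :=
  Fin n ⊕ Σ i, {c : (X i).Cell // ¬ c.IsDiag}

namespace AttachedPoset

variable (X : Fin k → Piece n)

instance : Fintype (AttachedPoset X) :=
  inferInstanceAs (Fintype (Fin n ⊕ Σ i, {c : (X i).Cell // ¬ c.IsDiag}))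

/-- The diagonal entry `x_{a+1}`. -/
def diag (a : Fin n) : AttachedPoset X := Sum.inl a

/-- The map from the shifted diagram of the `i`-th piece to `P_n(X)`. The diagonal cells, from
top to bottom, go to the diagonal entries of the segment in decreasing order. -/
def cell (i : Fin k) (c : (X i).Cell) : AttachedPoset X :=
  if h : c.IsDiag then diag X ((X i).pos c.row.rev) else Sum.inr ⟨i, c, h⟩

/-- The relations that generate the order of `P_n(X)`: those of the chain
`x_1 < ⋯ < x_n` and those of the attached shifted Young posets. -/
inductive Gen : AttachedPoset X → AttachedPoset X → Prop
  | chain (a b : Fin n) (h : a ≤ b) : Gen (diag X a) (diag X b)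
  | piece (i : Fin k) (c d : (X i).Cell) (h : c ≤ d) : Gen (cell X i c) (cell X i d)

/-- An auxiliary integer-valued height, used to see that the generated preorder is a partial
order. -/
def height : AttachedPoset X → ℤ
  | Sum.inl a => 2 * (a : ℕ)
  | Sum.inr ⟨i, c, _⟩ =>
      2 * ((X i).start + (X i).size - 1 : ℤ) - (c.row : ℕ) - (c.col : ℕ)

theorem height_cell (i : Fin k) (c : (X i).Cell) :
    height X (cell X i c) =
      2 * ((X i).start + (X i).size - 1 : ℤ) - (c.row : ℕ) - (c.col : ℕ) := by
  by_cases h : c.IsDiag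
  · have hr := c.row.2
    have e : cell X i c = diag X ((X i).pos c.row.rev) := dif_pos h
    rw [e]
    simp only [diag, height, Piece.pos, Fin.val_rev]
    rw [ShiftedCell.IsDiag] at h
    rw [h]
    omega
  · have e : cell X i c = Sum.inr ⟨i, c, h⟩ := dif_neg h
    rw [e]
    rfl

theorem Gen.height_lt {u v : AttachedPoset X} (h : Gen X u v) (hne : u ≠ v) :
    height X u < height X v := by
  cases h with
  | chain a b h =>
    have hab : a ≠ b := fun e => hne (by rw [e])
    have : (a : ℕ) < b := lt_of_le_of_ne h (fun e => hab (Fin.ext e))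
    simp only [diag, height]
    omega
  | piece i c d h =>
    rw [height_cell, height_cell]
    have h1 : (d.row : ℕ) ≤ c.row := h.1
    have h2 : d.col ≤ c.col := h.2
    by_contra hlt
    exact hne (congrArg _ (ShiftedCell.ext_row_col (Fin.ext (by omega)) (by omega)))

theorem eq_or_height_lt {u v : AttachedPoset X} (h : Relation.ReflTransGen (Gen X) u v) :
    u = v ∨ height X u < height X v := by
  induction h with
  | refl => exact Or.inl rfl
  | @tail b c _ hbc ih =>
    by_cases e : b = c
    · exact e ▸ ih
    · have := hbc.height_lt X e
      rcases ih with rfl | ih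
      · exact Or.inr this
      · exact Or.inr (ih.trans this)

/-- The order of `P_n(X)`: the reflexive and transitive closure of the generating relations. -/
instance : PartialOrder (AttachedPoset X) where
  le := Relation.ReflTransGen (Gen X)
  le_refl _ := Relation.ReflTransGen.refl
  le_trans _ _ _ := Relation.ReflTransGen.trans
  le_antisymm u v h h' := by
    rcases eq_or_height_lt X h with e | e
    · exact e
    · rcases eq_or_height_lt X h' with e' | e'
      · exact e'.symm
      · exact absurd (e.trans e') (lt_irrefl _)

/-- `y` is of the level of the diagonal entry with index `a`: it is below this entry, and not
below the preceding one (if there is one). -/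
def IsOfLevel (a : Fin n) (y : AttachedPoset X) : Prop :=
  y ≤ diag X a ∧ ∀ b : Fin n, (b : ℕ) + 1 = a → ¬ y ≤ diag X b

/-- The number of elements of a level; this is `ℓ_{a+1}`. -/
def levelCard (a : Fin n) : ℕ := Nat.card {y : AttachedPoset X // IsOfLevel X a y}

/-- The exponent `∑_{i=1}^n (n - i) ℓ_i`. -/
def levelWeight : ℕ := ∑ a : Fin n, (n - ((a : ℕ) + 1)) * levelCard X a

end AttachedPoset

end

end QAttach

namespace QAttach

noncomputable section

/-! ### Summation over products and sigma types -/

/-! Add to `σ y` the number of diagonal entries above the level of `y`. Inside one piece this number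
is the row index plus a constant, so order-reversing maps become arrays with weakly increasing rows
and strictly increasing columns, over a strictly decreasing diagonal `M` (`strictDataEquiv`). The
total shift is `∑ (n - i) ℓ_i`, whence the power of `q` in front.

Once `M` is fixed the pieces are independent. With `e = λ + δ` and `A` the diagonal of a piece read
from top to bottom, its fillings have generating function `det (q ^ (A_i e_j)) / ∏ (q;q)_{e_j}`
(`hasSum_filling_weight`). This follows by removing the diagonal: the first off-diagonal `B`
interlaces with `A`, and what remains is a filling with diagonal `B` and row lengths `e - 1`. By
multilinearity the sum over `B` is taken row by row; geometric sums give differences of consecutive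
rows, which leave the determinant unchanged (`hasSum_fillingGF`). Up to a reversal of rows, which
accounts for the sign, the result is the normalized alternant at `x_a = q ^ M_a` (`factor_pow`).

The `q`-integral over the simplex is a sum over weakly decreasing exponents `M`
(`hasSum_simplexQIntegral`). A repetition in `M` occurs at neighbours lying in a common segment, and
the alternant of that segment vanishes, so only strict `M` contribute (`hasSum_strictAnti`). -/

theorem hasSum_sigma_of_nonneg {α : Type*} {β : α → Type*} {f : (Σ a, β a) → ℝ} {g : α → ℝ}
    {s : ℝ} (hf : ∀ x, 0 ≤ f x) (h : ∀ a, HasSum (fun b => f ⟨a, b⟩) (g a)) (hg : HasSum g s) :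
    HasSum f s := by
  have hs : Summable f := by
    refine (summable_sigma_of_nonneg hf).2 ⟨fun a => (h a).summable, ?_⟩
    simpa only [(h _).tsum_eq] using hg.summable
  have := (hs.hasSum.sigma h).unique hg
  rw [← this]
  exact hs.hasSum

theorem hasSum_pi_prod : ∀ {m : ℕ} {β : Fin m → Type*} {f : (i : Fin m) → β i → ℝ}
    {s : Fin m → ℝ}, (∀ i b, 0 ≤ f i b) → (∀ i, HasSum (f i) (s i)) →
    HasSum (fun B : (i : Fin m) → β i => ∏ i, f i (B i)) (∏ i, s i)
  | 0, β, f, s, _, _ => by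
    simp
  | m + 1, β, f, s, h0, h => by
    rw [← (Fin.consEquiv β).hasSum_iff]
    have ih := hasSum_pi_prod (fun (i : Fin m) b => h0 i.succ b) (fun i => h i.succ)
    have hsm := (h 0).summable.mul_of_nonneg ih.summable (fun b => h0 0 b)
      (fun B => Finset.prod_nonneg fun i _ => h0 _ _)
    have := (h 0).mul ih hsm
    rw [Fin.prod_univ_succ]
    refine this.congr_fun ?_
    intro x
    simp [Function.comp, Fin.consEquiv, Fin.prod_univ_succ]

/-- Multilinearity in the rows: row `i` depends on `B i` alone, so every Leibniz term is a product
of independent series. -/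
theorem hasSum_det {m : ℕ} {F : Fin m → ℕ → Fin m → ℝ} {S : Matrix (Fin m) (Fin m) ℝ}
    (h0 : ∀ i b j, 0 ≤ F i b j) (h : ∀ i j, HasSum (fun b => F i b j) (S i j)) :
    HasSum (fun B : Fin m → ℕ => (Matrix.of fun i j => F i (B i) j).det) S.det := by
  simp only [← Matrix.det_transpose S, Matrix.det_apply, Matrix.transpose_apply]
  have : ∀ B : Fin m → ℕ, (∑ σ : Equiv.Perm (Fin m), Equiv.Perm.sign σ •
      ∏ i, (Matrix.of fun i j => F i (B i) j) (σ i) i) =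
      ∑ σ : Equiv.Perm (Fin m), Equiv.Perm.sign σ • ∏ i, F i (B i) (σ i) := by
    intro B
    have := Matrix.det_transpose (Matrix.of fun i j => F i (B i) j)
    simp only [Matrix.det_apply, Matrix.transpose_apply, Matrix.of_apply] at this ⊢
    exact this.symm
  simp only [this]
  refine hasSum_sum fun σ _ => ?_
  exact (hasSum_pi_prod (f := fun i b => F i b (σ i)) (fun i b => h0 i b _)
    (fun i => h i _)).const_smul _

/-! ### The `q`-integral over the simplex as a sum over antitone sequences -/

/-- The weights `(1 - q) b q ^ i` sum to `b ≤ 1`, so the bound on `g` is also a bound for its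
integral and survives iteration. -/
theorem qIntegrable_of_bounded {q : ℝ} (hq0 : 0 < q) (hq1 : q < 1) {g : ℝ → ℝ} {b C : ℝ}
    (hb0 : 0 ≤ b) (hb1 : b ≤ 1) (hC : 0 ≤ C) (hg : ∀ y ∈ Set.Icc 0 b, |g y| ≤ C) :
    QIntegrable q g 0 b ∧ |qIntegral q g 0 b| ≤ C := by
  have hgeo : HasSum (fun i : ℕ => (1 - q) * C * q ^ i) C := by
    have := (hasSum_geometric_of_lt_one hq0.le hq1).mul_left ((1 - q) * C)
    have h1 : (1 - q) ≠ 0 := by linarith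
    rwa [mul_right_comm, mul_inv_cancel₀ h1, one_mul] at this
  have hterm : ∀ i : ℕ, |qTerm q g 0 b i| ≤ (1 - q) * C * q ^ i := by
    intro i
    have hqi : 0 ≤ q ^ i := by positivity
    have hy : b * q ^ i ∈ Set.Icc 0 b :=
      ⟨by positivity, mul_le_of_le_one_right hb0 (pow_le_one₀ hq0.le hq1.le)⟩
    have := hg _ hy
    simp only [qTerm, zero_mul, mul_zero, sub_zero]
    rw [abs_mul, abs_mul, abs_of_pos (by linarith : 0 < 1 - q), abs_of_nonneg hy.1, mul_assoc]
    refine mul_le_mul_of_nonneg_left ?_ (by linarith)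
    refine mul_le_mul this ?_ hy.1 hC
    exact mul_le_of_le_one_left hqi hb1
  have hsum : Summable fun i => ‖qTerm q g 0 b i‖ :=
    Summable.of_nonneg_of_le (fun i => norm_nonneg _) hterm hgeo.summable
  refine ⟨hsum, ?_⟩
  calc |qIntegral q g 0 b| ≤ ∑' i, ‖qTerm q g 0 b i‖ := norm_tsum_le_tsum_norm hsum
    _ ≤ ∑' i : ℕ, (1 - q) * C * q ^ i := hsum.tsum_le_tsum hterm hgeo.summable
    _ = C := hgeo.tsum_eq

theorem simplexQIntegrable_of_bounded {q : ℝ} (hq0 : 0 < q) (hq1 : q < 1) :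
    ∀ (m : ℕ) (f : (Fin m → ℝ) → ℝ) (b C : ℝ), 0 ≤ b → b ≤ 1 →
      (∀ x : Fin m → ℝ, (∀ j, x j ∈ Set.Icc 0 b) → |f x| ≤ C) →
      SimplexQIntegrable q m f b ∧ |simplexQIntegral q m f b| ≤ C
  | 0, f, b, C, _, _, h => ⟨trivial, h _ fun j => j.elim0⟩
  | m + 1, f, b, C, hb0, hb1, h => by
    have hC : 0 ≤ C := (abs_nonneg _).trans (h (fun _ => 0) fun _ => ⟨le_rfl, hb0⟩)
    have ih : ∀ y ∈ Set.Icc 0 b, SimplexQIntegrable q m (fun x => f (Fin.snoc x y)) y ∧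
        |simplexQIntegral q m (fun x => f (Fin.snoc x y)) y| ≤ C := fun y hy =>
      simplexQIntegrable_of_bounded hq0 hq1 m _ y C hy.1 (hy.2.trans hb1) fun x hx => by
        refine h _ fun j => ?_
        refine Fin.lastCases ?_ (fun i => ?_) j
        · simpa using hy
        · simpa using ⟨(hx i).1, (hx i).2.trans hy.2⟩
    have := qIntegrable_of_bounded hq0 hq1 hb0 hb1 hC fun y hy => (ih y hy).2
    exact ⟨⟨fun y hy => (ih y hy).1, this.1⟩, this.2⟩

/-- Slices the summation region by its last exponent, which belongs to the outermost integration
variable. -/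
theorem antitone_snoc_and_le_iff {m : ℕ} (M : Fin m → ℕ) (y N : ℕ) :
    (Antitone (Fin.snoc M y : Fin (m + 1) → ℕ) ∧
        ∀ j, N ≤ (Fin.snoc M y : Fin (m + 1) → ℕ) j) ↔
      N ≤ y ∧ Antitone M ∧ ∀ j, y ≤ M j := by
  constructor
  · rintro ⟨h, h'⟩
    refine ⟨by simpa using h' (Fin.last m), fun i j hij => ?_, fun j => ?_⟩
    · simpa using h (Fin.castSucc_le_castSucc_iff.2 hij)
    · simpa using h (Fin.le_last j.castSucc)
  · rintro ⟨h1, h2, h3⟩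
    constructor
    · intro i j
      refine Fin.lastCases ?_ (fun j' => ?_) j
      · refine Fin.lastCases ?_ (fun i' => ?_) i
        · simp
        · intro _
          simpa using h3 i'
      · refine Fin.lastCases ?_ (fun i' => ?_) i
        · intro h
          exact absurd h (not_le.2 (Fin.castSucc_lt_last j'))
        · intro h
          simpa using h2 (Fin.castSucc_le_castSucc_iff.1 h)
    · intro j
      refine Fin.lastCases ?_ (fun j' => ?_) j
      · simpa using h1
      · simpa using h1.trans (h3 j')

-- The nodes below `q ^ N` are `q ^ (N + i)`, so an upper limit `q ^ N` becomes a lower bound `N`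
-- for exponents. The inner limit is the next variable, hence the need for general `N` in the
-- induction.
open Classical in
theorem hasSum_simplexQIntegral {q : ℝ} (hq0 : 0 < q) (hq1 : q < 1) :
    ∀ (m : ℕ) (f : (Fin m → ℝ) → ℝ) (C : ℝ) (N : ℕ),
      (∀ x : Fin m → ℝ, (∀ j, x j ∈ Set.Icc 0 1) → |f x| ≤ C) →
      HasSum (fun M : Fin m → ℕ => if Antitone M ∧ ∀ j, N ≤ M j then
        (1 - q) ^ m * (f (fun j => q ^ M j) * q ^ ∑ j, M j) else 0)
        (simplexQIntegral q m f (q ^ N))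
  | 0, f, C, N, h => by
    have := hasSum_unique (fun M : Fin 0 → ℕ => if Antitone M ∧ ∀ j, N ≤ M j then
        (1 - q) ^ 0 * (f (fun j => q ^ M j) * q ^ ∑ j, M j) else 0)
    convert this using 1
    rw [if_pos ⟨fun i => i.elim0, fun i => i.elim0⟩]
    simp only [simplexQIntegral, pow_zero, Finset.univ_eq_empty, Finset.sum_empty, mul_one, one_mul]
    exact congrArg f (Subsingleton.elim _ _)
  | m + 1, f, C, N, h => by
    have hqM : ∀ k : ℕ, q ^ k ∈ Set.Icc (0 : ℝ) 1 := fun k =>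
      ⟨by positivity, pow_le_one₀ hq0.le hq1.le⟩
    set F : (Fin (m + 1) → ℕ) → ℝ := fun M => if Antitone M ∧ ∀ j, N ≤ M j then
        (1 - q) ^ (m + 1) * (f (fun j => q ^ M j) * q ^ ∑ j, M j) else 0 with hF
    have hC : 0 ≤ C := (abs_nonneg _).trans (h (fun _ => 0) fun _ => by simp)
    -- Domination by `C ∏ q ^ M_j`; absolute summability permits regrouping by the last exponent.
    have hsF : Summable F := by
      have hg : Summable fun M : Fin (m + 1) → ℕ => C * ∏ j, q ^ M j :=
        (hasSum_pi_prod (f := fun (_ : Fin (m + 1)) (b : ℕ) => q ^ b) (fun i b => by positivity)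
          (fun i => hasSum_geometric_of_lt_one hq0.le hq1)).summable.mul_left C
      refine Summable.of_norm_bounded hg fun M => ?_
      rw [hF]
      simp only
      split_ifs
      · rw [Finset.prod_pow_eq_pow_sum, norm_mul, norm_mul, Real.norm_eq_abs, Real.norm_eq_abs,
          Real.norm_eq_abs, abs_of_nonneg (hqM _).1]
        have h1 : |(1 - q) ^ (m + 1)| ≤ 1 := by
          rw [abs_of_nonneg (pow_nonneg (by linarith) _)]
          exact pow_le_one₀ (by linarith) (by linarith)
        have h2 := h (fun j => q ^ M j) fun j => hqM _
        have h3 := (hqM (∑ j, M j)).1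
        exact (mul_le_of_le_one_left (by positivity) h1).trans (mul_le_mul_of_nonneg_right h2 h3)
      · rw [norm_zero]
        exact mul_nonneg hC (Finset.prod_nonneg fun j _ => (hqM _).1)
    set G : ℕ → ℝ := fun y => if N ≤ y then
      (1 - q) * (simplexQIntegral q m (fun x => f (Fin.snoc x (q ^ y))) (q ^ y) * q ^ y) else 0
      with hG
    have hinner : ∀ y, HasSum (fun M : Fin m → ℕ => F (Fin.snoc M y)) (G y) := by
      intro y
      have ih := hasSum_simplexQIntegral hq0 hq1 m (fun x => f (Fin.snoc x (q ^ y))) C y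
        (fun x hx => h _ fun j => by
          refine Fin.lastCases ?_ (fun i => ?_) j
          · simpa using hqM y
          · simpa using hx i)
      by_cases hy : N ≤ y
      · have := ih.mul_left ((1 - q) * q ^ y)
        have e : G y = (1 - q) * q ^ y *
            simplexQIntegral q m (fun x => f (Fin.snoc x (q ^ y))) (q ^ y) := by
          simp only [hG, if_pos hy]
          ring
        rw [e]
        refine this.congr_fun fun M => ?_
        simp only [hF, antitone_snoc_and_le_iff, hy, true_and]
        split_ifs
        · have : (fun j => q ^ (Fin.snoc M y : Fin (m + 1) → ℕ) j) =
              (Fin.snoc (fun j => q ^ M j) (q ^ y) : Fin (m + 1) → ℝ) := by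
            funext j
            refine Fin.lastCases ?_ (fun i => ?_) j <;> simp
          rw [this, Fin.sum_univ_castSucc]
          simp only [Fin.snoc_castSucc, Fin.snoc_last, pow_add, pow_succ]
          ring
        · simp
      · simp only [hG, hF, antitone_snoc_and_le_iff, hy, false_and, if_false]
        exact hasSum_zero
    have hs : HasSum (F ∘ Fin.snocEquiv fun _ => ℕ) (∑' M, F M) :=
      (Equiv.hasSum_iff _).2 hsF.hasSum
    have hGs : HasSum G (∑' M, F M) := hs.prod_fiberwise hinner
    -- `G` vanishes below `N`, so shifting the index by `N` loses nothing.
    have hGN : HasSum (fun i => G (N + i)) (∑' M, F M) := by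
      refine (Function.Injective.hasSum_iff (add_right_injective N) ?_).2 hGs
      intro y hy
      simp only [hG]
      rw [if_neg]
      intro hNy
      exact hy ⟨y - N, by simp only; omega⟩
    have : simplexQIntegral q (m + 1) f (q ^ N) = ∑' M, F M := by
      rw [simplexQIntegral, qIntegral, ← hGN.tsum_eq]
      refine tsum_congr fun i => ?_
      simp only [qTerm, hG, zero_mul, mul_zero, sub_zero, ← pow_add, Nat.le_add_right, if_true]
    rw [this]
    exact hsF.hasSum

/-! ### Reversing the rows of a determinant -/

/-- Every pair is an inversion, and entry `j` has `j` predecessors. -/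
theorem sign_revPerm (m : ℕ) : Equiv.Perm.sign (Fin.revPerm : Equiv.Perm (Fin m)) =
    (-1) ^ m.choose 2 := by
  rw [Equiv.Perm.sign_eq_prod_prod_Iio]
  have : ∀ j : Fin m, (∏ i ∈ Finset.Iio j,
      if (Fin.revPerm i : Fin m) < Fin.revPerm j then (1 : ℤˣ) else -1) = (-1) ^ (j : ℕ) := by
    intro j
    rw [Finset.prod_congr rfl (g := fun _ => -1)]
    · simp
    · intro i hi
      rw [if_neg]
      simpa using (Finset.mem_Iio.1 hi).le
  rw [Finset.prod_congr rfl fun j _ => this j, Finset.prod_pow_eq_pow_sum,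
    Fin.sum_univ_eq_sum_range (fun i => i), Finset.sum_range_id, Nat.choose_two_right]

theorem det_submatrix_rev {m : ℕ} (A : Matrix (Fin m) (Fin m) ℝ) :
    (A.submatrix Fin.rev id).det = (-1) ^ m.choose 2 * A.det := by
  have := Matrix.det_permute (Fin.revPerm : Equiv.Perm (Fin m)) A
  rw [sign_revPerm] at this
  push_cast at this
  exact this

/-! ### Determinants of row differences -/

/-- Subtracting from each row of a square matrix the next one does not change the determinant. -/
theorem det_row_sub_succ {m : ℕ} (N : ℕ → Fin m → ℝ) :
    (Matrix.of fun i j : Fin m => N i j - if (i : ℕ) + 1 < m then N (i + 1) j else 0).det =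
      (Matrix.of fun i j : Fin m => N i j).det := by
  cases m with
  | zero => simp
  | succ m =>
    -- Reversing rows and columns together keeps the determinant and turns the next row into the
    -- preceding one.
    rw [← Matrix.det_submatrix_equiv_self Fin.revPerm,
      ← Matrix.det_submatrix_equiv_self Fin.revPerm (Matrix.of fun i j : Fin (m + 1) => N i j)]
    symm
    refine Matrix.det_eq_of_forall_row_eq_smul_add_pred (fun _ => 1) ?_ ?_
    · intro j
      simp
    · intro i j
      have hi := i.2
      have h1 : m + 1 - (i + 1) < m + 1 := by omega
      have h2 : m + 1 - (i + 1 + 1) + 1 = m + 1 - (i + 1) := by omega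
      simp only [Matrix.submatrix_apply, Matrix.of_apply, Fin.revPerm_apply, Fin.val_rev,
        Fin.val_succ, Fin.val_castSucc, h1, h2, if_true]
      ring

/-- If the last column of a square matrix is constant one, the determinant is that of the
differences of consecutive rows, without the last row and column. -/
theorem det_row_sub_succ_of_last_eq_one {m : ℕ} (N : ℕ → ℕ → ℝ) (h : ∀ i, N i m = 1) :
    (Matrix.of fun i j : Fin m => N i j - N (i + 1) j).det =
      (Matrix.of fun i j : Fin (m + 1) => N i j).det := by
  -- After the subtraction the last column is `(0, …, 0, 1)`; expand along it.
  rw [← det_row_sub_succ fun i (j : Fin (m + 1)) => N i j,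
    Matrix.det_succ_column _ (Fin.last m), Fin.sum_univ_castSucc]
  rw [Finset.sum_eq_zero]
  · simp only [Matrix.of_apply, Fin.val_last, h, lt_irrefl, if_false, sub_zero, zero_add, mul_one,
      ← two_mul, pow_mul, neg_one_sq, one_pow, one_mul]
    congr 1
    ext i j
    simp [Matrix.submatrix_apply, Fin.succAbove_last]
  · intro i _
    simp [h]

/-! ### Column-strict fillings of shifted shapes with a given diagonal -/

/-- Extension of a finite sequence by zeros. -/
def extendZero {m : ℕ} (B : Fin m → ℕ) (r : ℕ) : ℕ := if h : r < m then B ⟨r, h⟩ else 0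

theorem extendZero_of_lt {m : ℕ} (B : Fin m → ℕ) {r : ℕ} (h : r < m) :
    extendZero B r = B ⟨r, h⟩ := dif_pos h

theorem extendZero_val {m : ℕ} (B : Fin m → ℕ) (r : Fin m) : extendZero B r = B r :=
  dif_pos r.2

theorem extendZero_of_le {m : ℕ} (B : Fin m → ℕ) {r : ℕ} (h : m ≤ r) :
    extendZero B r = 0 := dif_neg (not_lt.2 h)

/-- `T` fills the shifted diagram with `m` rows that has `e r` off-diagonal cells in row `r`; the
value `T r t` is that of the cell in row `r` and column `r + t`. The rows are weakly increasing,
the columns are strictly increasing, and the diagonal is `A`. Outside of the diagram (and the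
`0`-th cells of all rows) the values are zero. -/
structure IsFilling (m : ℕ) (e A : ℕ → ℕ) (T : ℕ → ℕ → ℕ) : Prop where
  diag : ∀ r, T r 0 = A r
  support : ∀ r t, ¬ (r < m ∧ t < e r) → T r (t + 1) = 0
  row : ∀ r t, r < m → t < e r → T r t ≤ T r (t + 1)
  col : ∀ r t, r + 1 < m → t ≤ e (r + 1) → T r (t + 1) < T (r + 1) t

/-- The fillings of a shifted diagram with given diagonal. -/
def Filling (m : ℕ) (e A : ℕ → ℕ) : Type := {T : ℕ → ℕ → ℕ // IsFilling m e A T}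

/-- The sum of the off-diagonal values of a filling. -/
def Filling.weight {m : ℕ} {e A : ℕ → ℕ} (T : Filling m e A) : ℕ :=
  ∑ r ∈ Finset.range m, ∑ t ∈ Finset.range (e r), T.1 r (t + 1)

/-- The possible values of the first off-diagonal cell of row `r`. -/
def interlaceSet (m : ℕ) (A : ℕ → ℕ) (r : ℕ) : Set ℕ :=
  {b | A r ≤ b ∧ (r + 1 < m → b < A (r + 1))}

/-- A filling is determined by its first off-diagonal and the filling that starts there. -/
def fillingEquiv {m m' : ℕ} {e : ℕ → ℕ} (A : ℕ → ℕ) (h1 : m' ≤ m) (h2 : m ≤ m' + 1)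
    (he : ∀ r < m', 0 < e r) (he' : ∀ r, m' ≤ r → r < m → e r = 0) :
    Filling m e A ≃ Σ B : {B : Fin m' → ℕ // ∀ i : Fin m', B i ∈ interlaceSet m A i},
      Filling m' (fun r => e r - 1) (extendZero B.1) where
  toFun T := ⟨⟨fun r => T.1 r 1, fun i => by
      have hi := i.2
      refine ⟨?_, fun hm => ?_⟩
      · rw [← T.2.diag]
        exact T.2.row i 0 (by omega) (he i hi)
      · rw [← T.2.diag]
        exact T.2.col i 0 hm (Nat.zero_le _)⟩,
    ⟨fun r t => T.1 r (t + 1), by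
      constructor
      · intro r
        by_cases hr : r < m'
        · rw [extendZero_of_lt _ hr]
        · rw [extendZero_of_le _ (not_lt.1 hr)]
          refine T.2.support r 0 fun h => ?_
          have := he' r (not_lt.1 hr) h.1
          omega
      · intro r t h
        refine T.2.support r (t + 1) fun h' => h ⟨?_, by omega⟩
        by_contra hr
        have := he' r (not_lt.1 hr) h'.1
        omega
      · intro r t hr ht
        exact T.2.row r (t + 1) (by omega) (by omega)
      · intro r t hr ht
        have := he (r + 1) hr
        exact T.2.col r (t + 1) (by omega) (by omega)⟩⟩
  invFun S := ⟨fun r t => Nat.casesOn t (A r) (fun t => S.2.1 r t), by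
      constructor
      · intro r
        rfl
      · intro r t h
        change S.2.1 r t = 0
        cases t with
        | zero =>
          rw [S.2.2.diag]
          refine extendZero_of_le _ (not_lt.1 fun hr => h ⟨by omega, he r hr⟩)
        | succ t => exact S.2.2.support r t fun h' => h ⟨by omega, by omega⟩
      · intro r t hr ht
        have hr' : r < m' := by
          by_contra hr'
          have := he' r (not_lt.1 hr') hr
          omega
        cases t with
        | zero =>
          change A r ≤ S.2.1 r 0
          rw [S.2.2.diag, extendZero_of_lt _ hr']
          exact (S.1.2 ⟨r, hr'⟩).1
        | succ t => exact S.2.2.row r t hr' (by omega)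
      · intro r t hr ht
        cases t with
        | zero =>
          change S.2.1 r 0 < A (r + 1)
          have hr' : r < m' := by omega
          rw [S.2.2.diag, extendZero_of_lt _ hr']
          exact (S.1.2 ⟨r, hr'⟩).2 hr
        | succ t =>
          have hr' : r + 1 < m' := by
            by_contra hr'
            have := he' (r + 1) (not_lt.1 hr') hr
            omega
          exact S.2.2.col r t hr' (by omega)⟩
  left_inv T := by
    apply Subtype.ext
    funext r t
    cases t with
    | zero => exact (T.2.diag r).symm
    | succ t => rfl
  right_inv S := by
    obtain ⟨⟨B, hB⟩, ⟨S, hS⟩⟩ := S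
    -- `B` is the `0`-th column of `S`; after substituting it the round trip is definitional.
    have : B = fun r : Fin m' => S r 0 := by
      funext r
      rw [hS.diag, extendZero_val]
    subst this
    rfl

theorem weight_fillingEquiv {m m' : ℕ} {e : ℕ → ℕ} (A : ℕ → ℕ) (h1 : m' ≤ m) (h2 : m ≤ m' + 1)
    (he : ∀ r < m', 0 < e r) (he' : ∀ r, m' ≤ r → r < m → e r = 0) (T : Filling m e A) :
    T.weight = (∑ i, (fillingEquiv A h1 h2 he he' T).1.1 i) +
      (fillingEquiv A h1 h2 he he' T).2.weight := by
  have : T.weight = ∑ r ∈ Finset.range m', ∑ t ∈ Finset.range (e r), T.1 r (t + 1) := by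
    rw [Filling.weight]
    symm
    apply Finset.sum_subset
    · intro r
      simp only [Finset.mem_range]
      omega
    · intro r hr hr'
      rw [Finset.mem_range] at hr hr'
      simp [he' r (not_lt.1 hr') hr]
  rw [this]
  change _ = (∑ i : Fin m', T.1 i 1) +
    ∑ r ∈ Finset.range m', ∑ t ∈ Finset.range (e r - 1), T.1 r (t + 1 + 1)
  rw [Fin.sum_univ_eq_sum_range (fun i => T.1 i 1), ← Finset.sum_add_distrib]
  refine Finset.sum_congr rfl fun r hr => ?_
  obtain ⟨k, hk⟩ := Nat.exists_eq_succ_of_ne_zero (he r (Finset.mem_range.1 hr)).ne'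
  rw [hk, Finset.sum_range_succ', add_comm, Nat.succ_sub_one]

/-! ### The generating function of the fillings -/

/-- `det (q ^ (A_i e_j)) / ∏_j (q;q)_{e_j}`. -/
def fillingGF (q : ℝ) (m : ℕ) (e A : ℕ → ℕ) : ℝ :=
  (Matrix.of fun i j : Fin m => q ^ (A i * e j)).det / ∏ j : Fin m, qPoch q q (e j)

-- A difference of two geometric tails of ratio `q ^ e`; the last row has no upper bound and gives a
-- single tail.
open Classical in
theorem hasSum_interlaceSet {q : ℝ} (hq0 : 0 < q) (hq1 : q < 1) {m : ℕ} {A : ℕ → ℕ} {r e : ℕ}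
    (he : 0 < e) (hA : r + 1 < m → A r ≤ A (r + 1)) :
    HasSum (fun b => if b ∈ interlaceSet m A r then q ^ (b * e) else 0)
      ((q ^ (A r * e) - if r + 1 < m then q ^ (A (r + 1) * e) else 0) * (1 - q ^ e)⁻¹) := by
  have tail : ∀ a : ℕ, HasSum (fun b => if a ≤ b then q ^ (b * e) else 0)
      (q ^ (a * e) * (1 - q ^ e)⁻¹) := by
    intro a
    have hg := (hasSum_geometric_of_lt_one (r := q ^ e) (by positivity)
      (pow_lt_one₀ hq0.le hq1 he.ne')).mul_left (q ^ (a * e))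
    rw [← Function.Injective.hasSum_iff (add_right_injective a)]
    · refine hg.congr_fun fun i => ?_
      simp only [Function.comp, Nat.le_add_right, if_true]
      rw [add_mul, pow_add, ← pow_mul, mul_comm e i]
    · intro b hb
      rw [if_neg]
      intro hab
      exact hb ⟨b - a, by simp only; omega⟩
  by_cases hr : r + 1 < m
  · simp only [hr, if_true]
    rw [sub_mul]
    refine ((tail (A r)).sub (tail (A (r + 1)))).congr_fun fun b => ?_
    have := hA hr
    simp only [interlaceSet, Set.mem_ofPred_eq, hr, true_imp_iff]
    by_cases h1 : A r ≤ b
    · by_cases h2 : b < A (r + 1)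
      · simp [h1, h2, not_le.2 h2]
      · simp [h1, h2, not_lt.1 h2]
    · have h2 : ¬ A (r + 1) ≤ b := by omega
      simp [h1, h2]
  · simp only [hr, if_false, sub_zero]
    simpa [interlaceSet, hr] using tail (A r)

/-- The step that removes one diagonal. Summing row by row gives differences of consecutive rows,
and the factors `(1 - q ^ e_j)⁻¹` come out of the columns to complete `(q;q)_{e_j - 1}` to
`(q;q)_{e_j}`. -/
theorem hasSum_fillingGF {q : ℝ} (hq0 : 0 < q) (hq1 : q < 1) {m m' : ℕ} {e : ℕ → ℕ} {A : ℕ → ℕ}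
    (h1 : m' ≤ m) (h2 : m ≤ m' + 1) (he : ∀ r < m', 0 < e r)
    (he' : ∀ r, m' ≤ r → r < m → e r = 0) (hA : ∀ r, r + 1 < m → A r ≤ A (r + 1)) :
    HasSum (fun B : {B : Fin m' → ℕ // ∀ i : Fin m', B i ∈ interlaceSet m A i} =>
      q ^ (∑ i, B.1 i) * fillingGF q m' (fun r => e r - 1) (extendZero B.1))
      (fillingGF q m e A) := by
  classical
  have key := hasSum_det (m := m')
    (F := fun i b j => if b ∈ interlaceSet m A i then q ^ (b * e j) else 0)
    (S := Matrix.of fun i j : Fin m' =>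
      (q ^ (A i * e j) - if (i : ℕ) + 1 < m then q ^ (A (i + 1) * e j) else 0) *
        (1 - q ^ e j)⁻¹)
    (fun i b j => by split_ifs <;> positivity)
    (fun i j => hasSum_interlaceSet hq0 hq1 (he j j.2) (hA i))
  have hpoch : ∏ j : Fin m, qPoch q q (e j) =
      (∏ j : Fin m', (1 - q ^ e j)) * ∏ j : Fin m', qPoch q q (e j - 1) := by
    rw [Fin.prod_univ_eq_prod_range (fun j => qPoch q q (e j)),
      Fin.prod_univ_eq_prod_range (fun j => 1 - q ^ e j),
      Fin.prod_univ_eq_prod_range (fun j => qPoch q q (e j - 1)), ← Finset.prod_mul_distrib,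
      ← Finset.prod_subset (s₁ := Finset.range m')]
    · refine Finset.prod_congr rfl fun r hr => ?_
      obtain ⟨k, hk⟩ := Nat.exists_eq_succ_of_ne_zero (he r (Finset.mem_range.1 hr)).ne'
      rw [hk, Nat.succ_sub_one, qPoch, Finset.prod_range_succ, qPoch, mul_comm, Nat.succ_eq_add_one,
        pow_succ']
    · intro r
      simp only [Finset.mem_range]
      omega
    · intro r hr hr'
      rw [Finset.mem_range] at hr hr'
      simp [he' r (not_lt.1 hr') hr, qPoch]
  have hdet : (Matrix.of fun i j : Fin m' =>
      q ^ (A i * e j) - if (i : ℕ) + 1 < m then q ^ (A (i + 1) * e j) else 0).det =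
      (Matrix.of fun i j : Fin m => q ^ (A i * e j)).det := by
    -- If the last row has no off-diagonal cell, its exponent `0` gives a column of ones and the
    -- size drops by one.
    obtain rfl | rfl : m = m' ∨ m = m' + 1 := by omega
    · exact det_row_sub_succ fun i (j : Fin m) => q ^ (A i * e j)
    · rw [← det_row_sub_succ_of_last_eq_one (fun i j => q ^ (A i * e j))
        (fun i => by simp [he' m' le_rfl (Nat.lt_succ_self _)])]
      congr 1
      ext i j
      simp
  have hS : (Matrix.of fun i j : Fin m' =>
      (q ^ (A i * e j) - if (i : ℕ) + 1 < m then q ^ (A (i + 1) * e j) else 0) *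
        (1 - q ^ e j)⁻¹).det = (∏ j : Fin m', (1 - q ^ e j)⁻¹) *
      (Matrix.of fun i j : Fin m => q ^ (A i * e j)).det := by
    rw [← hdet, ← Matrix.det_mul_row]
    congr 1
    ext i j
    simp [mul_comm]
  have hval : fillingGF q m e A = (Matrix.of fun i j : Fin m' =>
      (q ^ (A i * e j) - if (i : ℕ) + 1 < m then q ^ (A (i + 1) * e j) else 0) *
        (1 - q ^ e j)⁻¹).det * (∏ j : Fin m', qPoch q q (e j - 1))⁻¹ := by
    rw [hS, fillingGF, hpoch, div_eq_mul_inv, mul_inv, Finset.prod_inv_distrib]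
    ring
  rw [hval]
  have key2 := key.mul_right (∏ j : Fin m', qPoch q q (e j - 1))⁻¹
  have hind : (fun B : {B : Fin m' → ℕ // ∀ i : Fin m', B i ∈ interlaceSet m A i} =>
      q ^ (∑ i, B.1 i) * fillingGF q m' (fun r => e r - 1) (extendZero B.1)) =
      (fun B : Fin m' → ℕ => (Matrix.of fun i j : Fin m' =>
        if B i ∈ interlaceSet m A i then q ^ (B i * e j) else 0).det *
          (∏ j : Fin m', qPoch q q (e j - 1))⁻¹) ∘ Subtype.val := by
    funext B
    simp only [Function.comp, B.2, if_true, fillingGF, extendZero_val, div_eq_mul_inv,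
      ← mul_assoc]
    congr 1
    -- Scaling row `i` by `q ^ B_i` raises the exponent `e_j - 1` to `e_j`.
    rw [← Finset.prod_pow_eq_pow_sum, ← Matrix.det_mul_column]
    congr 1
    ext i j
    obtain ⟨k, hk⟩ := Nat.exists_eq_succ_of_ne_zero (he j j.2).ne'
    simp only [Matrix.of_apply, hk, Nat.succ_sub_one, ← pow_add, Nat.mul_succ, add_comm]
  rw [hind]
  refine (Function.Injective.hasSum_iff Subtype.val_injective ?_).2 key2
  intro B hB
  -- A non-interlacing `B` produces a zero row, so the sum may run over all `B`.
  have : ∃ i : Fin m', B i ∉ interlaceSet m A i := by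
    by_contra! h
    exact hB ⟨⟨B, h⟩, rfl⟩
  obtain ⟨i, hi⟩ := this
  rw [Matrix.det_eq_zero_of_row_eq_zero i, zero_mul]
  intro j
  simp [hi]

theorem hasSum_filling_weight_zero (q : ℝ) (e A : ℕ → ℕ) :
    HasSum (fun T : Filling 0 e A => q ^ T.weight) (fillingGF q 0 e A) := by
  have : Unique (Filling 0 e A) :=
    { default := ⟨fun r t => Nat.casesOn t (A r) fun _ => 0,
        fun r => rfl, fun r t _ => rfl, fun r t hr => absurd hr (Nat.not_lt_zero _),
        fun r t hr => absurd hr (Nat.not_lt_zero _)⟩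
      uniq := fun T => by
        apply Subtype.ext
        funext r t
        cases t with
        | zero => exact T.2.diag r
        | succ t => exact T.2.support r t fun h => Nat.not_lt_zero _ h.1 }
  convert hasSum_unique (fun T : Filling 0 e A => q ^ T.weight) using 1
  simp [fillingGF, Filling.weight]

/-- Induction on a bound for `m + e 0`, since removing the diagonal always shortens the first row.
-/
theorem hasSum_filling_weight {q : ℝ} (hq0 : 0 < q) (hq1 : q < 1) (c : ℕ) :
    ∀ (m : ℕ) (e A : ℕ → ℕ), m + e 0 ≤ c → (∀ r, r + 1 < m → e (r + 1) < e r) →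
      (∀ r, r + 1 < m → A r ≤ A (r + 1)) →
      HasSum (fun T : Filling m e A => q ^ T.weight) (fillingGF q m e A) := by
  induction c with
  | zero =>
    intro m e A hc _ _
    obtain rfl : m = 0 := by omega
    exact hasSum_filling_weight_zero q e A
  | succ c ih =>
    intro m e A hc hE hA
    by_cases hm : m = 0
    · subst hm
      exact hasSum_filling_weight_zero q e A
    -- `m'` counts the rows with an off-diagonal cell; as `e` strictly decreases, only the last row
    -- can lack one.
    obtain ⟨m', h1, h2, he, he', hlt⟩ : ∃ m', m' ≤ m ∧ m ≤ m' + 1 ∧ (∀ r < m', 0 < e r) ∧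
        (∀ r, m' ≤ r → r < m → e r = 0) ∧ m' + (e 0 - 1) ≤ c := by
      by_cases h0 : e (m - 1) = 0
      · refine ⟨m - 1, by omega, by omega, fun r hr => ?_, fun r hr hr' => ?_, by omega⟩
        · have := hE r (by omega)
          omega
        · rwa [show r = m - 1 by omega]
      · have he : ∀ r < m, 0 < e r := fun r hr => by
          by_cases hr' : r + 1 < m
          · have := hE r hr'
            omega
          · rw [show r = m - 1 by omega]
            omega
        have := he 0 (by omega)
        exact ⟨m, le_rfl, by omega, he, fun r hr hr' => by omega, by omega⟩
    rw [← (fillingEquiv A h1 h2 he he').symm.hasSum_iff]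
    refine hasSum_sigma_of_nonneg (fun _ => by simp only [Function.comp]; positivity)
      (fun B => ?_) (hasSum_fillingGF hq0 hq1 h1 h2 he he' hA)
    have hB := ih m' (fun r => e r - 1) (extendZero B.1) hlt
      (fun r hr => by
        have := hE r (by omega)
        have := he _ hr
        omega)
      -- Interlacing keeps the new diagonal increasing: `B_r < A_{r+1} ≤ B_{r+1}`.
      (fun r hr => by
        have hr' : r < m' := by omega
        rw [extendZero_of_lt _ hr, extendZero_of_lt _ hr']
        exact ((B.2 ⟨r, hr'⟩).2 (by simp only; omega)).le.trans (B.2 ⟨r + 1, hr⟩).1)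
    refine (hB.mul_left (q ^ ∑ i, B.1 i)).congr_fun fun T => ?_
    simp only [Function.comp]
    rw [weight_fillingEquiv A h1 h2 he he', Equiv.apply_symm_apply, pow_add]

/-! ### Fillings as functions on the cells -/

theorem IsFilling.row_le {m : ℕ} {e A : ℕ → ℕ} {T : ℕ → ℕ → ℕ} (h : IsFilling m e A T) {r : ℕ}
    (hr : r < m) (t s : ℕ) (hts : t + s ≤ e r) : T r t ≤ T r (t + s) := by
  induction s with
  | zero => exact le_rfl
  | succ s ih => exact (ih (by omega)).trans (h.row r (t + s) hr (by omega))

/-- Both cells lie in column `r + d + t`, and each of the `d` steps down gains at least one. The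
second conclusion keeps the upper cell inside the diagram. -/
theorem IsFilling.col_le {m : ℕ} {e A : ℕ → ℕ} {T : ℕ → ℕ → ℕ} (h : IsFilling m e A T)
    (hE : ∀ r, r + 1 < m → e (r + 1) < e r) (r d : ℕ) :
    ∀ t, r + d < m → t ≤ e (r + d) → T r (t + d) + d ≤ T (r + d) t ∧ t + d ≤ e r := by
  induction d with
  | zero => exact fun t _ ht => ⟨le_rfl, ht⟩
  | succ d ih =>
    intro t hr ht
    have h1 := hE (r + d) hr
    have h2 := ih (t + 1) (by omega) (lt_of_le_of_lt ht h1)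
    have h3 := h.col (r + d) t hr ht
    rw [add_right_comm t 1 d] at h2
    refine ⟨?_, h2.2⟩
    have := h2.1
    rw [← add_assoc r d 1, ← add_assoc t d 1]
    omega

/-- Go right along row `r` to the column of the target, then down that column. -/
theorem IsFilling.add_le {m : ℕ} {e A : ℕ → ℕ} {T : ℕ → ℕ → ℕ} (h : IsFilling m e A T)
    (hE : ∀ r, r + 1 < m → e (r + 1) < e r) {r r' t t' : ℕ} (hr : r ≤ r') (hr' : r' < m)
    (ht' : t' ≤ e r') (hc : r + t ≤ r' + t') : T r t + r' ≤ T r' t' + r := by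
  obtain ⟨d, rfl⟩ := Nat.exists_eq_add_of_le hr
  obtain ⟨h1, h2⟩ := h.col_le hE r d t' hr' ht'
  obtain ⟨s, hs⟩ := Nat.exists_eq_add_of_le (show t ≤ t' + d by omega)
  have h3 := h.row_le (by omega : r < m) t s (by omega)
  rw [← hs] at h3
  omega

namespace Piece

variable {n : ℕ} (p : Piece n)

/-- The extra `1` is the diagonal cell, so `exponent` counts the off-diagonal cells of a row. -/
theorem strictShape_eq (r : Fin p.size) : p.strictShape r = p.exponent r + 1 := by
  have := r.2
  simp only [strictShape, exponent, staircase, Fin.val_castSucc]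
  omega

theorem cell_le_exponent (c : p.Cell) : (c.2 : ℕ) ≤ extendZero p.exponent c.1 := by
  rw [extendZero_val]
  exact Nat.lt_succ_iff.1 (c.2.2.trans_eq (p.strictShape_eq c.1))

theorem exponent_strictAnti (r : ℕ) (hr : r + 1 < p.size) :
    extendZero p.exponent (r + 1) < extendZero p.exponent r := by
  rw [extendZero_of_lt _ hr, extendZero_of_lt _ (by omega : r < p.size)]
  have : p.shape ⟨r + 1, hr⟩ ≤ p.shape ⟨r, by omega⟩ :=
    p.shape_antitone (Fin.mk_le_mk.2 (Nat.le_succ r))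
  simp only [exponent, staircase]
  omega

open Classical in
/-- The array of the values of a function on the cells, extended by zeros. -/
def arrayOf (V : p.Cell → ℕ) (r t : ℕ) : ℕ :=
  if h : ∃ hr : r < p.size, t < p.strictShape ⟨r, hr⟩ then V ⟨⟨r, h.1⟩, ⟨t, h.2⟩⟩ else 0

theorem arrayOf_of_lt (V : p.Cell → ℕ) {r t : ℕ} (hr : r < p.size)
    (ht : t < p.strictShape ⟨r, hr⟩) : p.arrayOf V r t = V ⟨⟨r, hr⟩, ⟨t, ht⟩⟩ :=
  dif_pos ⟨hr, ht⟩

theorem arrayOf_cell (V : p.Cell → ℕ) (c : p.Cell) : p.arrayOf V c.1 c.2 = V c :=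
  p.arrayOf_of_lt V c.1.2 c.2.2

theorem arrayOf_eq_zero (V : p.Cell → ℕ) {r t : ℕ}
    (h : ∀ hr : r < p.size, p.strictShape ⟨r, hr⟩ ≤ t) : p.arrayOf V r t = 0 :=
  dif_neg fun ⟨hr, ht⟩ => absurd ht (not_lt.2 (h hr))

/-- `hV` at horizontal neighbours gives weak rows; at vertical neighbours the row indices differ by
one, which gives strict columns. -/
theorem isFilling_arrayOf {V : p.Cell → ℕ} {D : Fin p.size → ℕ}
    (hV : ∀ c d : p.Cell, c ≤ d → V d + c.row ≤ V c + d.row)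
    (hD : ∀ c : p.Cell, c.IsDiag → V c = D c.row) :
    IsFilling p.size (extendZero p.exponent) (extendZero D) (p.arrayOf V) := by
  have hlt : ∀ (r t : ℕ) (hr : r < p.size), t ≤ extendZero p.exponent r →
      t < p.strictShape ⟨r, hr⟩ := by
    intro r t hr ht
    rw [extendZero_of_lt _ hr] at ht
    rw [strictShape_eq]
    omega
  constructor
  · intro r
    by_cases hr : r < p.size
    · rw [extendZero_of_lt _ hr, p.arrayOf_of_lt V hr (hlt r 0 hr (Nat.zero_le _))]
      exact hD _ rfl
    · rw [extendZero_of_le _ (not_lt.1 hr), arrayOf_eq_zero]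
      exact fun h => absurd h hr
  · intro r t h
    refine p.arrayOf_eq_zero V fun hr => ?_
    have : ¬ t < p.exponent ⟨r, hr⟩ := fun ht => h ⟨hr, by rwa [extendZero_of_lt _ hr]⟩
    rw [strictShape_eq]
    omega
  · intro r t hr ht
    rw [p.arrayOf_of_lt V hr (hlt r t hr ht.le), p.arrayOf_of_lt V hr (hlt r (t + 1) hr ht)]
    have := hV ⟨⟨r, hr⟩, ⟨t + 1, hlt r (t + 1) hr ht⟩⟩ ⟨⟨r, hr⟩, ⟨t, hlt r t hr ht.le⟩⟩
      ⟨le_rfl, by simp only [ShiftedCell.col]; omega⟩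
    simpa [ShiftedCell.row] using this
  · intro r t hr ht
    have hr' : r < p.size := by omega
    have h1 := hlt (r + 1) t hr ht
    have h2 := hlt r (t + 1) hr' (lt_of_le_of_lt ht (p.exponent_strictAnti r hr))
    rw [p.arrayOf_of_lt V hr h1, p.arrayOf_of_lt V hr' h2]
    have := hV ⟨⟨r + 1, hr⟩, ⟨t, h1⟩⟩ ⟨⟨r, hr'⟩, ⟨t + 1, h2⟩⟩
      ⟨Fin.mk_le_mk.2 (Nat.le_succ r), by simp only [ShiftedCell.col]; omega⟩
    simp only [ShiftedCell.row] at this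
    omega

theorem arrayOf_restrict {A : ℕ → ℕ} {T : ℕ → ℕ → ℕ}
    (hA : ∀ r, p.size ≤ r → A r = 0)
    (hT : IsFilling p.size (extendZero p.exponent) A T) :
    p.arrayOf (fun c => T c.1 c.2) = T := by
  funext r t
  by_cases h : ∃ hr : r < p.size, t < p.strictShape ⟨r, hr⟩
  · rw [p.arrayOf_of_lt _ h.1 h.2]
  · have h' : ∀ hr : r < p.size, p.strictShape ⟨r, hr⟩ ≤ t := fun hr =>
      not_lt.1 fun ht => h ⟨hr, ht⟩
    rw [p.arrayOf_eq_zero _ h']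
    cases t with
    | zero =>
      rw [hT.diag, hA]
      by_contra hr
      have := h' (not_le.1 hr)
      rw [strictShape_eq] at this
      omega
    | succ t =>
      rw [hT.support]
      rintro ⟨hr, ht⟩
      have := h' hr
      rw [strictShape_eq] at this
      rw [extendZero_of_lt _ hr] at ht
      omega

theorem restrict_add_le {A : ℕ → ℕ} {T : ℕ → ℕ → ℕ}
    (hT : IsFilling p.size (extendZero p.exponent) A T) {c d : p.Cell} (h : c ≤ d) :
    T d.1 d.2 + c.1 ≤ T c.1 c.2 + d.1 := by
  exact hT.add_le p.exponent_strictAnti h.1 c.1.2 (p.cell_le_exponent c) h.2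

theorem sum_offDiag (T : ℕ → ℕ → ℕ) :
    ∑ c : {c : p.Cell // ¬ c.IsDiag}, T c.1.1 c.1.2 =
      ∑ r ∈ Finset.range p.size, ∑ t ∈ Finset.range (extendZero p.exponent r), T r (t + 1) := by
  have h1 : ∑ c : {c : p.Cell // ¬ c.IsDiag}, T c.1.1 c.1.2 =
      ∑ c : p.Cell, if (c.2 : ℕ) = 0 then 0 else T c.1 c.2 := by
    rw [← Finset.sum_subtype (Finset.univ.filter fun c : p.Cell => ¬ c.IsDiag) (by simp)
      (fun c : p.Cell => T c.1 c.2), Finset.sum_filter]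
    refine Finset.sum_congr rfl fun c _ => ?_
    have : c.IsDiag ↔ (c.2 : ℕ) = 0 := by
      simp only [ShiftedCell.IsDiag, ShiftedCell.col, ShiftedCell.row]
      omega
    simp only [this, ite_not]
  have h2 : (∑ c : p.Cell, if (c.2 : ℕ) = 0 then 0 else T c.1 c.2) =
      ∑ r : Fin p.size, ∑ t : Fin (p.strictShape r), if (t : ℕ) = 0 then 0 else T r t :=
    Fintype.sum_sigma (fun c : Σ r : Fin p.size, Fin (p.strictShape r) =>
      if (c.2 : ℕ) = 0 then 0 else T c.1 c.2)
  rw [h1, h2, ← Fin.sum_univ_eq_sum_range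
    (fun r => ∑ t ∈ Finset.range (extendZero p.exponent r), T r (t + 1))]
  refine Finset.sum_congr rfl fun r _ => ?_
  rw [Fin.sum_univ_eq_sum_range (fun t => if t = 0 then 0 else T r t), strictShape_eq,
    extendZero_val, Finset.sum_range_succ']
  simp

end Piece

/-! ### The levels of the attached poset -/

namespace AttachedPoset

variable {n k : ℕ} (X : Fin k → Piece n)

/-- The least diagonal entry above an element. -/
def level : AttachedPoset X → Fin n
  | Sum.inl a => a
  | Sum.inr ⟨i, c, _⟩ => (X i).pos c.row.rev

theorem cell_of_isDiag (i : Fin k) {c : (X i).Cell} (h : c.IsDiag) :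
    cell X i c = diag X ((X i).pos c.row.rev) := dif_pos h

theorem cell_of_not_isDiag (i : Fin k) {c : (X i).Cell} (h : ¬ c.IsDiag) :
    cell X i c = Sum.inr ⟨i, c, h⟩ := dif_neg h

theorem level_cell (i : Fin k) (c : (X i).Cell) :
    level X (cell X i c) = (X i).pos c.row.rev := by
  by_cases h : c.IsDiag
  · rw [cell_of_isDiag X i h]
    rfl
  · rw [cell_of_not_isDiag X i h]
    rfl

theorem Gen.level_le {u v : AttachedPoset X} (h : Gen X u v) : level X u ≤ level X v := by
  cases h with
  | chain a b h => exact h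
  | piece i c d h =>
    rw [level_cell, level_cell, Fin.le_def]
    have : (d.row : ℕ) ≤ c.row := h.1
    simp only [Piece.pos, Fin.val_rev]
    omega

theorem level_mono {u v : AttachedPoset X} (h : u ≤ v) : level X u ≤ level X v := by
  have h' : Relation.ReflTransGen (Gen X) u v := h
  clear h
  induction h' with
  | refl => exact le_rfl
  | tail _ hbc ih => exact ih.trans (hbc.level_le X)

theorem le_of_gen {u v : AttachedPoset X} (h : Gen X u v) : u ≤ v := Relation.ReflTransGen.single h

theorem le_diag_level (y : AttachedPoset X) : y ≤ diag X (level X y) := by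
  rcases y with a | ⟨i, c, hc⟩
  · exact le_refl (diag X a)
  · have h0 : 0 < (X i).strictShape c.row := by
      rw [Piece.strictShape_eq]
      omega
    have h : c ≤ (⟨c.row, ⟨0, h0⟩⟩ : (X i).Cell) :=
      ⟨le_rfl, by simp [ShiftedCell.col, ShiftedCell.row]⟩
    have := le_of_gen X (Gen.piece i _ _ h)
    rw [cell_of_not_isDiag X i hc] at this
    exact this.trans_eq (cell_of_isDiag X i rfl)

theorem le_diag_iff (y : AttachedPoset X) (b : Fin n) : y ≤ diag X b ↔ level X y ≤ b :=
  ⟨fun h => level_mono X h, fun h => (le_diag_level X y).trans (le_of_gen X (Gen.chain _ _ h))⟩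

theorem isOfLevel_iff (a : Fin n) (y : AttachedPoset X) : IsOfLevel X a y ↔ level X y = a := by
  simp only [IsOfLevel, le_diag_iff, Fin.le_def, Fin.ext_iff]
  constructor
  · rintro ⟨h1, h2⟩
    by_contra hne
    have ha := a.2
    exact h2 ⟨a - 1, by omega⟩ (by simp only; omega) (by simp only; omega)
  · intro h
    exact ⟨h.le, fun b hb => by omega⟩

/-- The number of diagonal entries above the level of an element. -/
def depth (a : Fin n) : ℕ := n - ((a : ℕ) + 1)

theorem levelWeight_eq : levelWeight X = ∑ y, depth (level X y) := by
  classical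
  rw [levelWeight, ← Finset.sum_fiberwise (g := level X)]
  refine Finset.sum_congr rfl fun a _ => ?_
  rw [Finset.sum_congr rfl (g := fun _ => depth a), Finset.sum_const, smul_eq_mul, mul_comm,
    levelCard]
  · congr 1
    simp only [isOfLevel_iff]
    rw [Nat.card_eq_fintype_card, Fintype.card_subtype]
  · intro y hy
    rw [(Finset.mem_filter.1 hy).2]

/-- Why the shift by `depth` works: within a piece it is constant along rows and grows by one per
row downwards. -/
theorem depth_pos_rev (i : Fin k) (r : Fin (X i).size) :
    depth ((X i).pos r.rev) = n - ((X i).start + (X i).size) + r := by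
  have := (X i).fits
  have := r.2
  simp only [depth, Piece.pos, Fin.val_rev]
  omega

/-! ### Decomposition of the `P`-partitions -/

/-- A strictly decreasing sequence on the diagonal, and for each piece a column-strict filling
with the corresponding diagonal. -/
abbrev StrictData : Type :=
  Σ M : {M : Fin n → ℕ // StrictAnti M}, ∀ i, Filling (X i).size (extendZero (X i).exponent)
    (extendZero fun r => M.1 ((X i).pos r.rev))

variable {X}

theorem StrictData.ext {S S' : StrictData X} (h1 : S.1.1 = S'.1.1)
    (h2 : ∀ i, (S.2 i).1 = (S'.2 i).1) : S = S' := by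
  obtain ⟨⟨M, hM⟩, T⟩ := S
  obtain ⟨⟨M', hM'⟩, T'⟩ := S'
  simp only at h1
  subst h1
  have : T = T' := funext fun i => Subtype.ext (h2 i)
  rw [this]

/-- The value at an element. -/
def StrictData.val (S : StrictData X) : AttachedPoset X → ℕ
  | Sum.inl a => S.1.1 a
  | Sum.inr ⟨i, c, _⟩ => (S.2 i).1 c.1 c.2

theorem StrictData.val_cell (S : StrictData X) (i : Fin k) (c : (X i).Cell) :
    S.val (cell X i c) = (S.2 i).1 c.1 c.2 := by
  by_cases h : c.IsDiag
  · rw [cell_of_isDiag X i h]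
    have h0 : (c.2 : ℕ) = 0 := by
      simp only [ShiftedCell.IsDiag, ShiftedCell.col, ShiftedCell.row] at h
      omega
    rw [h0, (S.2 i).2.diag, extendZero_val]
    rfl
  · rw [cell_of_not_isDiag X i h]
    rfl

/-- Per step `M` drops by at least one and `depth` by exactly one, so `M - depth` is still weakly
decreasing. -/
theorem add_depth_le {M : Fin n → ℕ} (hM : StrictAnti M) {a b : Fin n} (h : a ≤ b) :
    M b + depth a ≤ M a + depth b := by
  obtain ⟨d, hd⟩ := Nat.exists_eq_add_of_le (Fin.le_def.1 h)
  have : ∀ d (b : Fin n), (b : ℕ) = a + d → M b + d ≤ M a := by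
    intro d
    induction d with
    | zero =>
      intro b hb
      rw [show b = a from Fin.ext hb]
      exact le_rfl
    | succ d ih =>
      intro b hb
      have hb' := b.2
      have h1 := ih ⟨a + d, by omega⟩ rfl
      have h2 := hM (show (⟨a + d, by omega⟩ : Fin n) < b from Fin.lt_def.2 (by simp only; omega))
      omega
  have := this d b hd
  have := b.2
  simp only [depth]
  omega

theorem depth_le {M : Fin n → ℕ} (hM : StrictAnti M) (a : Fin n) : depth a ≤ M a := by
  have ha := a.2
  have := add_depth_le hM (show a ≤ ⟨n - 1, by omega⟩ from Fin.le_def.2 (by simp only; omega))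
  simp only [depth] at *
  omega

/-- Rows increase from the diagonal, where the bound is `depth_le`. Hence the natural-number
subtraction in `ofStrictData` never truncates. -/
theorem StrictData.depth_le_val (S : StrictData X) (y : AttachedPoset X) :
    depth (level X y) ≤ S.val y := by
  rcases y with a | ⟨i, c, hc⟩
  · exact depth_le S.1.2 a
  · have h := (S.2 i).2.row_le c.1.2 0 c.2 (by
      rw [zero_add]
      exact (X i).cell_le_exponent c)
    rw [(S.2 i).2.diag, extendZero_val, zero_add] at h
    exact (depth_le S.1.2 _).trans h

theorem StrictData.val_add_le (S : StrictData X) {u v : AttachedPoset X} (h : Gen X u v) :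
    S.val v + depth (level X u) ≤ S.val u + depth (level X v) := by
  cases h with
  | chain a b h => exact add_depth_le S.1.2 h
  | piece i c d h =>
    rw [S.val_cell, S.val_cell, level_cell, level_cell, depth_pos_rev, depth_pos_rev]
    have := (X i).restrict_add_le (S.2 i).2 h
    simp only [ShiftedCell.row]
    omega

theorem antitone_of_gen {f : AttachedPoset X → ℕ} (h : ∀ u v, Gen X u v → f v ≤ f u) :
    Antitone f := by
  intro u v huv
  have h' : Relation.ReflTransGen (Gen X) u v := huv
  clear huv
  induction h' with
  | refl => exact le_rfl
  | tail _ hbc ih => exact (h _ _ hbc).trans ih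

variable (X)

/-- Adding the depth of the level turns `P`-partitions into strict data. -/
def toStrictData (σ : PPartition (AttachedPoset X)) : StrictData X :=
  ⟨⟨fun a => σ.1 (diag X a) + depth a, fun a b hab => by
      have h1 := σ.2 (le_of_gen X (Gen.chain a b hab.le))
      have h2 := Fin.lt_def.1 hab
      have := b.2
      simp only [depth]
      omega⟩,
    fun i => ⟨(X i).arrayOf fun c => σ.1 (cell X i c) + depth ((X i).pos c.row.rev), by
      apply Piece.isFilling_arrayOf
      · intro c d h
        have := σ.2 (le_of_gen X (Gen.piece i c d h))
        rw [depth_pos_rev, depth_pos_rev]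
        omega
      · intro c hc
        rw [cell_of_isDiag X i hc]⟩⟩

theorem val_toStrictData (σ : PPartition (AttachedPoset X)) (y : AttachedPoset X) :
    (toStrictData X σ).val y = σ.1 y + depth (level X y) := by
  rcases y with a | ⟨i, c, hc⟩
  · rfl
  · have := (X i).arrayOf_cell (fun c => σ.1 (cell X i c) + depth ((X i).pos c.row.rev)) c
    rw [cell_of_not_isDiag X i hc] at this
    exact this

/-- Subtracting the depth of the level from strict data. -/
def ofStrictData (S : StrictData X) : PPartition (AttachedPoset X) :=
  ⟨fun y => S.val y - depth (level X y), antitone_of_gen fun u v h => by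
    have := S.val_add_le h
    have := S.depth_le_val u
    have := S.depth_le_val v
    omega⟩

theorem ofStrictData_add_depth (S : StrictData X) (y : AttachedPoset X) :
    (ofStrictData X S).1 y + depth (level X y) = S.val y :=
  Nat.sub_add_cancel (S.depth_le_val y)

/-- The correspondence between `P`-partitions and strict data. -/
def strictDataEquiv : PPartition (AttachedPoset X) ≃ StrictData X where
  toFun := toStrictData X
  invFun := ofStrictData X
  left_inv σ := by
    apply Subtype.ext
    funext y
    have h1 := ofStrictData_add_depth X (toStrictData X σ) y
    rw [val_toStrictData] at h1
    exact Nat.add_right_cancel h1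
  right_inv S := by
    apply StrictData.ext
    · funext a
      exact ofStrictData_add_depth X S (diag X a)
    · intro i
      rw [← (X i).arrayOf_restrict (fun r hr => extendZero_of_le _ hr) (S.2 i).2]
      have h : (fun c => (ofStrictData X S).1 (cell X i c) + depth ((X i).pos c.row.rev)) =
          fun c => (S.2 i).1 c.1 c.2 := by
        funext c
        rw [← S.val_cell, ← level_cell X]
        exact ofStrictData_add_depth X S _
      exact congrArg (X i).arrayOf h

theorem size_add_levelWeight (S : StrictData X) :
    ((strictDataEquiv X).symm S).size + levelWeight X =
      ∑ a, S.1.1 a + ∑ i, (S.2 i).weight := by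
  have h1 : ((strictDataEquiv X).symm S).size + levelWeight X = ∑ y, S.val y := by
    rw [levelWeight_eq, PPartition.size, ← Finset.sum_add_distrib]
    exact Finset.sum_congr rfl fun y _ => ofStrictData_add_depth X S y
  have h2 : ∑ y, S.val y = ∑ a, S.1.1 a +
      ∑ x : (Σ i, {c : (X i).Cell // ¬ c.IsDiag}), (S.2 x.1).1 x.2.1.1 x.2.1.2 :=
    Fintype.sum_sum_type S.val
  rw [h1, h2, Fintype.sum_sigma]
  congr 1
  exact Finset.sum_congr rfl fun i _ => (X i).sum_offDiag (S.2 i).1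

end AttachedPoset

/-! ### Normalized alternants at powers of `q` -/

namespace Piece

variable {n : ℕ} (p : Piece n)

theorem continuous_factor (q : ℝ) : Continuous (p.factor q) := by
  refine Continuous.div_const (Continuous.mul continuous_const ?_) _
  refine Continuous.matrix_det (continuous_matrix fun i j => ?_)
  exact (continuous_apply _).pow _

/-- At powers of `q`, the normalized alternant is the generating function of fillings. -/
theorem factor_pow (q : ℝ) (M : Fin n → ℕ) :
    p.factor q (fun a => q ^ M a) = fillingGF q p.size (extendZero p.exponent)
      (extendZero fun r => M (p.pos r.rev)) := by
  simp only [factor, fillingGF, alternant, extendZero_val]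
  -- The top diagonal cell carries the last variable of the segment; reversing the rows absorbs the
  -- sign.
  rw [← det_submatrix_rev]
  congr 2
  ext i j
  simp [pow_mul]

/-- Equal neighbouring variables in the segment give the alternant two equal rows. -/
theorem factor_eq_zero (q : ℝ) {x : Fin n → ℝ} {a b : Fin n} (hab : (a : ℕ) + 1 = b)
    (hx : x a = x b) (h1 : p.start ≤ a) (h2 : (a : ℕ) + 1 < p.start + p.size) :
    p.factor q x = 0 := by
  have hi : (a : ℕ) - p.start < p.size := by omega
  have hj : (b : ℕ) - p.start < p.size := by omega
  have ha : p.pos ⟨a - p.start, hi⟩ = a := Fin.ext (by simp only [pos]; omega)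
  have hb : p.pos ⟨b - p.start, hj⟩ = b := Fin.ext (by simp only [pos]; omega)
  have hne : (⟨a - p.start, hi⟩ : Fin p.size) ≠ ⟨b - p.start, hj⟩ := by
    rw [Ne, Fin.mk.injEq]
    omega
  have : alternant p.exponent (fun j => x (p.pos j)) = 0 := by
    refine Matrix.det_zero_of_row_eq hne ?_
    funext j
    simp only [Matrix.of_apply, ha, hb, hx]
  rw [factor, this, mul_zero, zero_div]

end Piece

theorem exists_eq_succ_of_not_strictAnti {n : ℕ} {M : Fin n → ℕ} (hM : Antitone M)
    (h : ¬ StrictAnti M) : ∃ a b : Fin n, (a : ℕ) + 1 = b ∧ M a = M b := by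
  by_contra! hne
  refine h fun a b hab => ?_
  have hlt := Fin.lt_def.1 hab
  have hb := b.2
  have h1 : M ⟨a + 1, by omega⟩ ≤ M a := hM (Fin.le_def.2 (Nat.le_succ _))
  have h2 : M b ≤ M ⟨a + 1, by omega⟩ := hM (Fin.le_def.2 hlt)
  exact h2.trans_lt (lt_of_le_of_ne h1 (hne a ⟨a + 1, by omega⟩ rfl).symm)

/-! ### Summation over the diagonal -/

namespace AttachedPoset

variable {n k : ℕ} (X : Fin k → Piece n)

theorem exists_bound_prod_factor (q : ℝ) : ∃ C, ∀ x : Fin n → ℝ, (∀ j, x j ∈ Set.Icc 0 1) →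
    |∏ i, (X i).factor q x| ≤ C := by
  have hc : Continuous fun x : Fin n → ℝ => ∏ i, (X i).factor q x :=
    continuous_finsetProd _ fun i _ => (X i).continuous_factor q
  obtain ⟨C, hC⟩ := (isCompact_univ_pi fun _ : Fin n => isCompact_Icc (a := (0 : ℝ)) (b := 1))
    |>.exists_bound_of_continuousOn hc.continuousOn
  exact ⟨C, fun x hx => hC x fun j _ => hx j⟩

/-- The covering hypothesis enters here: it kills the terms of the `q`-integral whose exponents
repeat. -/
theorem hasSum_strictAnti {q : ℝ} (hq0 : 0 < q) (hq1 : q < 1)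
    (hX : ∀ j : ℕ, j + 1 < n → ∃ i, (X i).start ≤ j ∧ j + 1 < (X i).start + (X i).size) :
    HasSum (fun M : {M : Fin n → ℕ // StrictAnti M} =>
      q ^ (∑ a, M.1 a) * ∏ i, (X i).factor q (fun a => q ^ M.1 a))
      (simplexQIntegral q n (fun x => ∏ i, (X i).factor q x) 1 / (1 - q) ^ n) := by
  classical
  obtain ⟨C, hC⟩ := exists_bound_prod_factor X q
  have h := hasSum_simplexQIntegral hq0 hq1 n _ C 0 hC
  rw [pow_zero] at h
  have h2 := (Function.Injective.hasSum_iff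
    (Subtype.val_injective (p := fun M : Fin n → ℕ => StrictAnti M)) ?_).2 h
  · refine (h2.div_const ((1 - q) ^ n)).congr_fun fun M => ?_
    have hne : (1 - q) ^ n ≠ 0 := pow_ne_zero _ (by linarith)
    simp only [Function.comp, M.2.antitone, Nat.zero_le, implies_true, and_self, if_true]
    field_simp
  · intro M hM
    by_cases hA : Antitone M
    · have hS : ¬ StrictAnti M := fun hS => hM ⟨⟨M, hS⟩, rfl⟩
      obtain ⟨a, b, hab, he⟩ := exists_eq_succ_of_not_strictAnti hA hS
      obtain ⟨i, hi1, hi2⟩ := hX a (by have := b.2; omega)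
      have hz : (X i).factor q (fun j => q ^ M j) = 0 :=
        (X i).factor_eq_zero q hab (by simp only [he]) hi1 hi2
      rw [Finset.prod_eq_zero (Finset.mem_univ i) hz, zero_mul, mul_zero, ite_self]
    · rw [if_neg fun h => hA h.1]

/-- For fixed `M` the sum factors over the pieces. All terms `q ^ …` are nonnegative, so summing
first over fillings and then over `M` is legitimate. -/
theorem hasSum_strictData {q : ℝ} (hq0 : 0 < q) (hq1 : q < 1)
    (hX : ∀ j : ℕ, j + 1 < n → ∃ i, (X i).start ≤ j ∧ j + 1 < (X i).start + (X i).size) :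
    HasSum (fun S : StrictData X => q ^ (∑ a, S.1.1 a + ∑ i, (S.2 i).weight))
      (simplexQIntegral q n (fun x => ∏ i, (X i).factor q x) 1 / (1 - q) ^ n) := by
  refine hasSum_sigma_of_nonneg (fun S => by positivity) (fun M => ?_)
    (hasSum_strictAnti X hq0 hq1 hX)
  have h := hasSum_pi_prod
    (f := fun i (T : Filling (X i).size (extendZero (X i).exponent)
      (extendZero fun r => M.1 ((X i).pos r.rev))) => q ^ T.weight)
    (fun i T => by positivity)
    (fun i => hasSum_filling_weight hq0 hq1 _ _ _ _ le_rfl (X i).exponent_strictAnti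
      fun r hr => by
        rw [extendZero_of_lt _ hr, extendZero_of_lt _ (by omega : r < (X i).size)]
        refine M.2.antitone (Fin.le_def.2 ?_)
        simp only [Piece.pos, Fin.val_rev]
        omega)
  simp only [Piece.factor_pow]
  refine (h.mul_left (q ^ ∑ a, M.1 a)).congr_fun fun T => ?_
  rw [pow_add, Finset.prod_pow_eq_pow_sum]

end AttachedPoset

end

end QAttach

/-! ### The theorem -/

theorem mainTheorem3 {n k : ℕ} (hn : 0 < n) (hk : 0 < k) (X : Fin k → QAttach.Piece n)
    (hX : ∀ j : ℕ, j + 1 < n →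
      ∃ i, (X i).start ≤ j ∧ j + 1 < (X i).start + (X i).size)
    (q : ℝ) (hq0 : 0 < q) (hq1 : q < 1) :
    (Summable fun σ : QAttach.PPartition (QAttach.AttachedPoset X) => q ^ σ.size) ∧
    QAttach.SimplexQIntegrable q n (fun x => ∏ i, (X i).factor q x) 1 ∧
    QAttach.GF q (QAttach.AttachedPoset X) =
      q ^ (-(QAttach.AttachedPoset.levelWeight X : ℤ)) / (1 - q) ^ n *
        QAttach.simplexQIntegral q n (fun x => ∏ i, (X i).factor q x) 1 := by
  have hsum : HasSum (fun σ : QAttach.PPartition (QAttach.AttachedPoset X) => q ^ σ.size)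
      (q ^ (-(QAttach.AttachedPoset.levelWeight X : ℤ)) / (1 - q) ^ n *
        QAttach.simplexQIntegral q n (fun x => ∏ i, (X i).factor q x) 1) := by
    rw [← (QAttach.AttachedPoset.strictDataEquiv X).symm.hasSum_iff, div_mul_eq_mul_div,
      mul_div_assoc]
    refine ((QAttach.AttachedPoset.hasSum_strictData X hq0 hq1 hX).mul_left _).congr_fun
      fun S => ?_
    have hw : q ^ QAttach.AttachedPoset.levelWeight X ≠ 0 := pow_ne_zero _ hq0.ne'
    rw [← QAttach.AttachedPoset.size_add_levelWeight, pow_add, zpow_neg, zpow_natCast]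
    simp only [Function.comp]
    field_simp
  obtain ⟨C, hC⟩ := QAttach.AttachedPoset.exists_bound_prod_factor X q
  exact ⟨hsum.summable,
    (QAttach.simplexQIntegrable_of_bounded hq0 hq1 n _ 1 C zero_le_one le_rfl hC).1,
    hsum.tsum_eq⟩
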